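/- **Setting.** An *APFA* $\mathcal A$ of length $p$ is a finite directed multigraph whose edges $e$ carry symbols $\sigma(e)$, with one root (no incoming edges) and one sink (no outgoing edges), such that every node lies on a path from the root to the sink, the outgoing edges of each node have distinct symbols, and all root-to-sink paths have the same length $p$. A node is at *level* $i$ if the paths from the root to it have length $i$. Let $\mathcal X_i$ be the set of symbols on edges into level $i$ nodes. Edge probabilities $\pi(e)\ge 0$ that sum to $1$ over the outgoing edges of each node other than the sink define a distribution of $(X_1,\dots,X_p)$ on $\mathcal X_1\times\dots\times\mathcal X_p$: the probability of $x$ is the product of the $\pi(e)$ along the root-to-sink path with symbol string $x$, and $0$ if there is none. The *model* of $\mathcal A$ is the set of the distributions obtained from all such $\pi$. $\mathcal A$ is *complete* if for $0\le i<p$ each level $i$ node has $|\mathcal X_{i+1}|$ outgoing edges. The Bayesian network of a directed graph on $\{1,\dots,p\}$ with parent sets $\mathrm{pa}(i)$ is the set of distributions on $\mathcal X_1\times\dots\times\mathcal X_p$ of the form $P(x)=\prod_i k_i(x_i\mid x_{\mathrm{pa}(i)})$ with conditional probability functions $k_i$; the graph is *consistent with the variable ordering* if $i<j$ for every edge $i\to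 j$. The undirected graphical model of an undirected graph on $\{1,\dots,p\}$ is the set of distributions on $\mathcal X_1\times\dots\times\mathcal X_p$ with the global Markov property: $X_B$ and $X_C$ are independent given $X_A$ whenever $A,B,C$ are disjoint and $A$ separates $B$ from $C$ in the graph. Two models are *equivalent* if they are the same set of distributions. $\mathcal A$ has *property Q* if for each $i$ with $1\le i\le p-1$ there is a set $A(i)\subseteq\{1,\dots,i\}$ such that for every level $i$ node $w$ there is a value $x_{A(i)}$, occurring on some path from the root to level $i$, such that the root-to-$w$ paths are exactly the paths from the root to level $i$ whose symbol string has $A(i)$-subvector $x_{A(i)}$. **Theorem 1.** Let $\mathcal A$ be a complete APFA of length $p$ in which each variable has at least two values, $|\mathcal X_i|\ge 2$ for $i=1,\dots,p$. Then 1. $\mathcal A$ is equivalent to the Bayesian network of some directed graph consistent with the variable ordering if and only if $\mathcal A$ has property Q; and 2. $\mathcal A$ is equivalent to the undirected graphical model of some undirected graph if and only if $\mathcal A$ has property Q. -/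

import Mathlib

noncomputable section

/-! ## Acyclic probabilistic finite automata -/

/-- In the directed multigraph with edge set `E`, source map `src` and target map `tgt`, the edge
sequence `e 0, …, e (n - 1)` is a path of length `n` from `u` to `w`; `v` lists the visited nodes. -/
def IsPath {V E : Type*} (src tgt : E → V) {n : ℕ} (e : Fin n → E) (u w : V) : Prop :=
  ∃ v : Fin (n + 1) → V, v 0 = u ∧ v (Fin.last n) = w ∧
    ∀ j : Fin n, src (e j) = v j.castSucc ∧ tgt (e j) = v j.succ

/-- The graph of a probabilistic finite automaton with symbols in `S`, all of whose root-to-sink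
paths have the same length `p`. The edge probabilities are the parameters of the model, see
`APFA.IsParameter`. -/
structure APFA (V E S : Type*) (p : ℕ) where
  /-- source of an edge -/
  src : E → V
  /-- target of an edge -/
  tgt : E → V
  /-- symbol of an edge -/
  sym : E → S
  /-- initial state -/
  root : V
  /-- final state -/
  sink : V
  tgt_ne_root : ∀ e, tgt e ≠ root
  src_ne_sink : ∀ e, src e ≠ sink
  /-- outgoing edges of a state have distinct symbols -/
  deterministic : ∀ e f, src e = src f → sym e = sym f → e = f
  root_to : ∀ v, ∃ (n : ℕ) (e : Fin n → E), IsPath src tgt e root v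
  to_sink : ∀ v, ∃ (n : ℕ) (e : Fin n → E), IsPath src tgt e v sink
  /-- all root-to-sink paths have length `p` -/
  length_eq : ∀ (n : ℕ) (e : Fin n → E), IsPath src tgt e root sink → n = p

namespace APFA

variable {V E S : Type*} {p : ℕ} (A : APFA V E S p)

/-- The root-to-`w` paths of length `i`. If `w` is a node at level `i`, these are all paths from
the root to `w`. -/
def pathsTo (i : ℕ) (w : V) : Set (Fin i → E) :=
  {e | IsPath A.src A.tgt e A.root w}

/-- `w` is a node at level `i`. -/
def IsLevel (i : ℕ) (w : V) : Prop := (A.pathsTo i w).Nonempty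

/-- The paths that start at the root and end at some node at level `i`. -/
def pathsToLevel (i : ℕ) : Set (Fin i → E) := {e | ∃ w, e ∈ A.pathsTo i w}

/-- The subvector, indexed by `B`, of the symbol string of a path. -/
def subvector {i : ℕ} (B : Finset (Fin i)) (e : Fin i → E) : B → S := fun j => A.sym (e j)

/-- The paths to level `i` whose symbol string has `B`-subvector `x`. -/
def pathsWith {i : ℕ} (B : Finset (Fin i)) (x : B → S) : Set (Fin i → E) :=
  {e | e ∈ A.pathsToLevel i ∧ A.subvector B e = x}

/-- Property Q: for each level `i` with `1 ≤ i ≤ p - 1` there is a set `B` of indices among the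
first `i` variables, such that for every node `w` at level `i` the set of root-to-`w` paths is the
set of paths to level `i` having `B`-subvector `x`, for some occurring value `x`. -/
def PropertyQ : Prop :=
  ∀ i : ℕ, 1 ≤ i → i < p → ∃ B : Finset (Fin i), ∀ w : V, A.IsLevel i w →
    ∃ x ∈ A.subvector B '' A.pathsToLevel i, A.pathsTo i w = A.pathsWith B x

variable [Fintype E]

open scoped Classical in
/-- The sample space of the variable with (zero-based) index `i`: the symbols of the edges whose
target is a node at level `i + 1`. -/
def sampleSpace (i : Fin p) : Finset S :=
  (Finset.univ.filter fun e => A.IsLevel (i + 1) (A.tgt e)).image A.sym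

open scoped Classical in
/-- No edge is absent: each node at a level `i < p` has as many outgoing edges as the variable
generated next has values. -/
def IsComplete : Prop :=
  ∀ (i : Fin p) (v : V), A.IsLevel i v →
    (Finset.univ.filter fun e => A.src e = v).card = (A.sampleSpace i).card

open scoped Classical in
/-- `π` is an assignment of edge probabilities. -/
def IsParameter (π : E → ℝ) : Prop :=
  (∀ e, 0 ≤ π e) ∧ ∀ v, v ≠ A.sink → ∑ e with A.src e = v, π e = 1

open scoped Classical in
/-- The joint probability mass function of the variables under the edge probabilities `π`. By
determinism, the sum has at most one term. -/
def pmf (π : E → ℝ) (x : (i : Fin p) → A.sampleSpace i) : ℝ :=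
  ∑ e : Fin p → E with IsPath A.src A.tgt e A.root A.sink ∧ ∀ i, A.sym (e i) = x i, ∏ i, π (e i)

/-- The set of distributions defined by the automaton, as its edge probabilities vary. -/
def model : Set (((i : Fin p) → A.sampleSpace i) → ℝ) :=
  {P | ∃ π : E → ℝ, A.IsParameter π ∧ P = A.pmf π}

end APFA

/-! ## Discrete graphical models -/

section GraphicalModels

variable {p : ℕ} {α : Fin p → Type*} [∀ i, Fintype (α i)]

/-- `P` is a probability mass function. -/
def IsPMF (P : ((i : Fin p) → α i) → ℝ) : Prop := (∀ x, 0 ≤ P x) ∧ ∑ x, P x = 1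

open scoped Classical in
/-- The probability that the variables with index in `s` take the values that `x` gives them. -/
def marginal (P : ((i : Fin p) → α i) → ℝ) (s : Finset (Fin p)) (x : (i : Fin p) → α i) : ℝ :=
  ∑ y with ∀ i ∈ s, y i = x i, P y

open scoped Classical in
/-- Under `P`, the variables in `s` and those in `t` are conditionally independent given those in
`c`. -/
def CondIndep (P : ((i : Fin p) → α i) → ℝ) (s t c : Finset (Fin p)) : Prop :=
  ∀ x, marginal P (s ∪ t ∪ c) x * marginal P c x = marginal P (s ∪ c) x * marginal P (t ∪ c) x

/-- The Bayesian network on `G`, for `G` consistent with the variable ordering: the distributions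
that factorize into conditional probabilities `k i a x` of the value `a` of variable `i`, each of
which depends on `x` through the values of the parents of `i` only. -/
def directedModel (α : Fin p → Type*) [∀ i, Fintype (α i)] (G : Digraph (Fin p)) :
    Set (((i : Fin p) → α i) → ℝ) :=
  {P | ∃ k : (i : Fin p) → α i → ((j : Fin p) → α j) → ℝ,
    (∀ i a x, 0 ≤ k i a x) ∧
    (∀ i x, ∑ a, k i a x = 1) ∧
    (∀ i a x y, (∀ j, G.Adj j i → x j = y j) → k i a x = k i a y) ∧
    ∀ x, P x = ∏ i, k i (x i) x}

/-- In the graph `H`, every path from `s` to `t` meets `c`. -/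
def Separates (H : SimpleGraph (Fin p)) (s t c : Finset (Fin p)) : Prop :=
  ∀ u ∈ s, ∀ v ∈ t, ∀ w : H.Walk u v, ∃ j ∈ c, j ∈ w.support

/-- The undirected graphical model (Markov network) on `H`: the distributions with the global
Markov property with respect to `H`. -/
def undirectedModel (α : Fin p → Type*) [∀ i, Fintype (α i)] (H : SimpleGraph (Fin p)) :
    Set (((i : Fin p) → α i) → ℝ) :=
  {P | IsPMF P ∧ ∀ s t c : Finset (Fin p), Disjoint s t → Disjoint s c → Disjoint t c →
    Separates H s t c → CondIndep P s t c}

end GraphicalModels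

end

/-! In a complete automaton every string has a unique run, and an edge amounts to a state together
with a symbol. Edge probabilities are therefore conditional probabilities of the next symbol that
depend on the past only through the current state (`APFA.model_eq_kernelModel`). A Bayesian network
has the same form, with "same state" replaced by "same parent values". Property Q says that the two
kinds of equivalence relation coincide for some parent sets (`APFA.propertyQ_iff`).

A set of distributions of this form determines its relations: two pasts are equivalent exactly when
every distribution in the set gives them the same conditional law (`rel_iff_sameConditional`).
Equality of models thus forces equality of relations, which settles the directed case.

For an undirected graph, the same test recovers agreement on the set of earlier vertices reachable
through non-earlier ones (`agreeOn_boundary_iff`), so equivalence again gives Q. Conversely, runs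
that have merged stay merged under equal symbols. The sets provided by Q hence satisfy a
monotonicity that makes every family (a variable with its parents) a clique of the skeleton, and the
directed and undirected models agree (`kernelModel_eq_undirectedModel`). -/

open Finset Function

/-! ### Kernel models and the recovery of their relations -/

section KernelModels

variable {p : ℕ} {α : Fin p → Type*} [∀ i, Fintype (α i)]

/-- Two strings are equivalent if they agree at the indices in `B`. -/
def agreeOn (α : Fin p → Type*) (B : Set (Fin p)) : Setoid ((i : Fin p) → α i) where
  r x y := ∀ j ∈ B, x j = y j
  iseqv := ⟨fun _ _ _ => rfl, fun h j hj => (h j hj).symm,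
    fun h h' j hj => (h j hj).trans (h' j hj)⟩

/-- The distributions that factorize into conditional probabilities `k i a x` of the value `a` of
variable `i`, each of which depends on `x` through its class under `r i` only. -/
def kernelModel (r : Fin p → Setoid ((i : Fin p) → α i)) : Set (((i : Fin p) → α i) → ℝ) :=
  {P | ∃ k : (i : Fin p) → α i → ((j : Fin p) → α j) → ℝ,
    (∀ i a x, 0 ≤ k i a x) ∧
    (∀ i x, ∑ a, k i a x = 1) ∧
    (∀ i a x y, r i x y → k i a x = k i a y) ∧
    ∀ x, P x = ∏ i, k i (x i) x}

theorem directedModel_eq_kernelModel (G : Digraph (Fin p)) :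
    directedModel α G = kernelModel fun i => agreeOn α {j | G.Adj j i} := rfl

theorem kernelModel_mono {r r' : Fin p → Setoid ((i : Fin p) → α i)}
    (h : ∀ i x y, r' i x y → r i x y) : kernelModel r ⊆ kernelModel r' := by
  rintro P ⟨k, h0, h1, hk, hP⟩
  exact ⟨k, h0, h1, fun i a x y hxy => hk i a x y (h i x y hxy), hP⟩

/-- The indices that are less than `n`. -/
def below (p n : ℕ) : Finset (Fin p) := univ.filter fun j => j.val < n

@[simp]
theorem mem_below {n : ℕ} {j : Fin p} : j ∈ below p n ↔ j.val < n := by simp [below]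

theorem below_succ (i : Fin p) : below p (i.val + 1) = insert i (below p i.val) := by
  ext j
  simp only [mem_below, mem_insert, Fin.ext_iff]
  omega

theorem notMem_below (i : Fin p) : i ∉ below p i.val := by simp

theorem below_length : below p p = univ := by
  ext j
  simp

theorem below_zero : below p 0 = ∅ := by
  ext j
  simp

section Marginals

variable {P : ((i : Fin p) → α i) → ℝ} {s t : Finset (Fin p)} {x y : (i : Fin p) → α i}

theorem marginal_congr (h : ∀ j ∈ s, x j = y j) : marginal P s x = marginal P s y := by
  classical
  unfold marginal
  refine Finset.sum_congr (Finset.filter_congr fun z _ => ?_) fun _ _ => rfl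
  exact forall₂_congr fun j hj => by rw [h j hj]

theorem marginal_update (a : α i) (hi : i ∉ s) :
    marginal P s (update x i a) = marginal P s x :=
  marginal_congr fun _ hj => update_of_ne (ne_of_mem_of_not_mem hj hi) _ _

theorem marginal_univ : marginal P univ x = P x := by
  classical
  unfold marginal
  rw [show (univ.filter fun z : (i : Fin p) → α i => ∀ i ∈ univ, z i = x i) = {x} by
    ext z; simp [funext_iff], sum_singleton]

theorem marginal_empty : marginal P ∅ x = ∑ z, P z := by
  simp [marginal]

theorem marginal_nonneg (hP : ∀ z, 0 ≤ P z) : 0 ≤ marginal P s x :=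
  Finset.sum_nonneg fun z _ => hP z

theorem le_marginal (hP : ∀ z, 0 ≤ P z) (h : ∀ j ∈ s, y j = x j) : P y ≤ marginal P s x := by
  classical
  unfold marginal
  exact Finset.single_le_sum (f := P) (fun z _ => hP z) (by simpa using h)

theorem marginal_anti (hP : ∀ z, 0 ≤ P z) (h : s ⊆ t) : marginal P t x ≤ marginal P s x := by
  classical
  unfold marginal
  refine Finset.sum_le_sum_of_subset_of_nonneg (fun z hz => ?_) fun z _ _ => hP z
  simp only [mem_filter, mem_univ, true_and] at hz ⊢
  exact fun i hi => hz i (h hi)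

theorem sum_marginal_insert {i : Fin p} (hi : i ∉ s) :
    ∑ a, marginal P (insert i s) (update x i a) = marginal P s x := by
  classical
  unfold marginal
  refine Eq.trans ?_ (Finset.sum_fiberwise _ (fun z => z i) _)
  refine Finset.sum_congr rfl fun a _ => Finset.sum_congr ?_ fun _ _ => rfl
  rw [Finset.filter_filter]
  refine Finset.filter_congr fun z _ => ?_
  simp only [mem_insert, forall_eq_or_imp, update_self]
  rw [and_comm]
  refine and_congr_left fun _ => forall₂_congr fun j hj => ?_
  rw [update_of_ne (ne_of_mem_of_not_mem hj hi)]

end Marginals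

/-- The marginal distribution of the first `n` variables is the product of their kernels. -/
theorem marginal_below {P : ((i : Fin p) → α i) → ℝ}
    {k : (i : Fin p) → α i → ((j : Fin p) → α j) → ℝ}
    (hsum : ∀ i x, ∑ a, k i a x = 1)
    (hk : ∀ i a x y, (∀ j < i, x j = y j) → k i a x = k i a y)
    (hP : ∀ x, P x = ∏ i, k i (x i) x) {n : ℕ} (hn : n ≤ p) (x : (i : Fin p) → α i) :
    marginal P (below p n) x = ∏ i ∈ below p n, k i (x i) x := by
  -- Downward from the full joint distribution: summing out the last remaining variable removes its
  -- kernel, and no earlier kernel sees that variable.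
  induction hn using Nat.decreasingInduction generalizing x with
  | self => rw [below_length, marginal_univ, hP]
  | of_succ n hn ih =>
    have key := sum_marginal_insert (P := P) (x := x) (notMem_below ⟨n, hn⟩)
    rw [← key, ← below_succ]
    simp_rw [ih]
    rw [show below p (n + 1) = insert ⟨n, hn⟩ (below p n) from below_succ ⟨n, hn⟩]
    have : ∀ a : α ⟨n, hn⟩, ∏ i ∈ insert ⟨n, hn⟩ (below p n),
        k i (update x ⟨n, hn⟩ a i) (update x ⟨n, hn⟩ a) =
        k ⟨n, hn⟩ a x * ∏ i ∈ below p n, k i (x i) x := by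
      intro a
      rw [prod_insert (notMem_below ⟨n, hn⟩), update_self]
      congr 1
      · exact hk _ _ _ _ fun j hj => update_of_ne hj.ne _ _
      · refine prod_congr rfl fun i hi => ?_
        have hin : i.val < n := by simpa using hi
        rw [update_of_ne (by simpa [Fin.ext_iff] using hin.ne)]
        refine hk _ _ _ _ fun j hj => update_of_ne ?_ _ _
        have : j.val < i.val := hj
        simp only [ne_eq, Fin.ext_iff]
        omega
    simp only [this]
    rw [← sum_mul, hsum, one_mul]

/-- Under `P`, the conditional distribution of variable `i` is the same for the pasts of `x` and of
`y`, in cross-multiplied form. -/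
def SameConditional (P : ((i : Fin p) → α i) → ℝ) (i : Fin p) (x y : (i : Fin p) → α i) : Prop :=
  ∀ a, marginal P (insert i (below p i)) (update x i a) * marginal P (below p i) y =
    marginal P (insert i (below p i)) (update y i a) * marginal P (below p i) x

/-- Every `r i` depends on the past of variable `i` only. -/
def Causal (r : Fin p → Setoid ((i : Fin p) → α i)) : Prop :=
  ∀ i x y, (∀ j < i, x j = y j) → r i x y

/-- The kernel is the conditional law given the past, in a form that stays valid when the past has
probability zero. -/
theorem marginal_insert_below {P : ((i : Fin p) → α i) → ℝ}
    {k : (i : Fin p) → α i → ((j : Fin p) → α j) → ℝ}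
    (hsum : ∀ i x, ∑ a, k i a x = 1)
    (hk : ∀ i a x y, (∀ j < i, x j = y j) → k i a x = k i a y)
    (hP : ∀ x, P x = ∏ i, k i (x i) x) (i : Fin p) (a : α i) (x : (i : Fin p) → α i) :
    marginal P (insert i (below p i)) (update x i a) = k i a x * marginal P (below p i) x := by
  rw [← marginal_update a (notMem_below i), ← below_succ,
    marginal_below hsum hk hP (Nat.succ_le_of_lt i.2), marginal_below hsum hk hP i.2.le, below_succ,
    prod_insert (notMem_below i), update_self]
  congr 1
  exact hk _ _ _ _ fun j hj => update_of_ne hj.ne _ _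

theorem sameConditional_of_mem {r : Fin p → Setoid ((i : Fin p) → α i)} (hr : Causal r)
    {P : ((i : Fin p) → α i) → ℝ} (hP : P ∈ kernelModel r) {i : Fin p} {x y : (i : Fin p) → α i}
    (hxy : r i x y) : SameConditional P i x y := by
  obtain ⟨k, -, h1, hk, hP⟩ := hP
  have hk' : ∀ i a x y, (∀ j < i, x j = y j) → k i a x = k i a y :=
    fun i a x y h => hk i a x y (hr i x y h)
  intro a
  rw [marginal_insert_below h1 hk' hP, marginal_insert_below h1 hk' hP, hk i a x y hxy]
  ring

/-- Variable `i` is made deterministic, equal to `b` on the class of `x` and to `c` off it; all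
others are uniform. Every past of `i` then has positive probability, so the conditional laws really
differ. -/
theorem exists_not_sameConditional [∀ i, Nontrivial (α i)]
    {r : Fin p → Setoid ((i : Fin p) → α i)} (hr : Causal r) {i : Fin p}
    {x y : (i : Fin p) → α i} (hxy : ¬ r i x y) :
    ∃ P ∈ kernelModel r, ¬ SameConditional P i x y := by
  classical
  obtain ⟨b, c, hbc⟩ := exists_pair_ne (α i)
  let k : (m : Fin p) → α m → ((j : Fin p) → α j) → ℝ := fun m a z =>
    if h : m = i then (if a = (if r i z x then h ▸ b else h ▸ c) then 1 else 0)
    else (Fintype.card (α m) : ℝ)⁻¹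
  have h0 : ∀ m a z, 0 ≤ k m a z := by
    intro m a z
    dsimp only [k]
    split_ifs <;> positivity
  have h1 : ∀ m z, ∑ a, k m a z = 1 := by
    intro m z
    by_cases h : m = i
    · subst h
      simp [k]
    · simp [k, h]
  have hk : ∀ m a z z', r m z z' → k m a z = k m a z' := by
    intro m a z z' hz
    by_cases h : m = i
    · subst h
      have : r m z x ↔ r m z' x :=
        ⟨fun h => (r m).trans' ((r m).symm' hz) h, fun h => (r m).trans' hz h⟩
      simp [k, this]
    · simp [k, h]
  refine ⟨fun z => ∏ m, k m (z m) z, ⟨k, h0, h1, hk, fun _ => rfl⟩, fun hsame => ?_⟩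
  have hk' : ∀ i a x y, (∀ j < i, x j = y j) → k i a x = k i a y :=
    fun i a x y h => hk i a x y (hr i x y h)
  have hpos : ∀ z, marginal (fun z => ∏ m, k m (z m) z) (below p i) z ≠ 0 := by
    intro z
    rw [marginal_below h1 hk' (fun _ => rfl) i.2.le, prod_ne_zero_iff]
    intro m hm
    have : m ≠ i := fun h => notMem_below i (h ▸ hm)
    simp [k, this]
  have := hsame b
  rw [marginal_insert_below h1 hk' (fun _ => rfl), marginal_insert_below h1 hk' (fun _ => rfl)] at this
  have hx : k i b x = 1 := by simp [k]
  have hyx : ¬ r i y x := fun h => hxy ((r i).symm' h)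
  have hy : k i b y = 0 := by simp [k, hyx, hbc]
  rw [hx, hy, one_mul, zero_mul, zero_mul] at this
  exact (mul_ne_zero (hpos x) (hpos y)) this

theorem rel_iff_sameConditional [∀ i, Nontrivial (α i)]
    {r : Fin p → Setoid ((i : Fin p) → α i)} (hr : Causal r) (i : Fin p)
    (x y : (i : Fin p) → α i) : r i x y ↔ ∀ P ∈ kernelModel r, SameConditional P i x y := by
  refine ⟨fun h P hP => sameConditional_of_mem hr hP h, fun h => ?_⟩
  by_contra hxy
  obtain ⟨P, hP, hne⟩ := exists_not_sameConditional hr hxy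
  exact hne (h P hP)

end KernelModels

/-! ### Undirected models and their comparison with kernel models -/

section MarkovNetworks

variable {p : ℕ} {α : Fin p → Type*} [∀ i, Fintype (α i)] {H : SimpleGraph (Fin p)}

open scoped Classical in
/-- The indices `j < i` that can be reached from `i` in `H` through indices `≥ i`. -/
noncomputable def boundary (H : SimpleGraph (Fin p)) (i : Fin p) : Finset (Fin p) :=
  univ.filter fun j => j < i ∧ ∃ w : H.Walk i j, ∀ v ∈ w.support, v = j ∨ i ≤ v

theorem mem_boundary {i j : Fin p} : j ∈ boundary H i ↔
    j < i ∧ ∃ w : H.Walk i j, ∀ v ∈ w.support, v = j ∨ i ≤ v := by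
  simp [boundary]

theorem lt_of_mem_boundary {i j : Fin p} (h : j ∈ boundary H i) : j < i := (mem_boundary.1 h).1

/-- The first vertex of the walk below `i` is in the boundary. For the induction, `w₀` records the
part already traversed, which starts at `i` and stays at or above it. -/
theorem exists_mem_boundary_of_walk {i u v : Fin p} (w : H.Walk u v) (hv : v < i)
    (w₀ : H.Walk i u) (h₀ : ∀ z ∈ w₀.support, i ≤ z) : ∃ j ∈ boundary H i, j ∈ w.support := by
  induction w with
  | nil => exact absurd (h₀ _ w₀.end_mem_support) (not_le.2 hv)
  | @cons u u' v h w ih =>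
    by_cases hu : u' < i
    · refine ⟨u', mem_boundary.2 ⟨hu, w₀.concat h, fun z hz => ?_⟩, by simp⟩
      rw [SimpleGraph.Walk.support_concat, List.mem_append, List.mem_singleton] at hz
      exact hz.symm.imp id (h₀ z)
    · obtain ⟨j, hj, hjw⟩ := ih hv (w₀.concat h) fun z hz => by
        rw [SimpleGraph.Walk.support_concat, List.mem_append, List.mem_singleton] at hz
        rcases hz with hz | rfl
        · exact h₀ z hz
        · exact not_lt.1 hu
      exact ⟨j, hj, by simp [hjw]⟩

theorem separates_boundary (H : SimpleGraph (Fin p)) (i : Fin p) :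
    Separates H {i} (below p i \ boundary H i) (boundary H i) := by
  intro u hu v hv w
  rw [mem_singleton] at hu
  subst hu
  have hv' : v < u := by
    have := (mem_sdiff.1 hv).1
    simpa using this
  exact exists_mem_boundary_of_walk w hv' .nil (by simp)

/-- The chain rule, where the boundary separates `i` from the rest of its past and so may replace
the whole past in the conditional law. -/
theorem undirectedModel_subset_kernelModel [∀ i, Nonempty (α i)] (H : SimpleGraph (Fin p)) :
    undirectedModel α H ⊆ kernelModel fun i => agreeOn α (boundary H i : Set (Fin p)) := by
  classical
  rintro P ⟨⟨h0, h1⟩, hM⟩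
  have hi : ∀ i, i ∉ boundary H i := fun i h => lt_irrefl _ (lt_of_mem_boundary h)
  have hsub : ∀ i, boundary H i ⊆ below p i := fun i j h => by
    simpa using lt_of_mem_boundary h
  -- The uniform value is arbitrary: where the boundary values have probability zero, so does
  -- everything in `hstep` that involves more coordinates.
  let k : (i : Fin p) → α i → ((j : Fin p) → α j) → ℝ := fun i a x =>
    if marginal P (boundary H i) x = 0 then (Fintype.card (α i) : ℝ)⁻¹
    else marginal P (insert i (boundary H i)) (update x i a) / marginal P (boundary H i) x
  have hstep : ∀ (i : Fin p) x, marginal P (below p (i.val + 1)) x =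
      k i (x i) x * marginal P (below p i.val) x := by
    intro i x
    have hci := hM {i} (below p i \ boundary H i) (boundary H i)
      (by simp) (by simpa using hi i) sdiff_disjoint (separates_boundary H i) x
    rw [show ({i} ∪ below p i \ boundary H i ∪ boundary H i) = below p (i.val + 1) by
      rw [union_assoc, sdiff_union_of_subset (hsub i), below_succ]; rfl,
      sdiff_union_of_subset (hsub i), ← insert_eq] at hci
    dsimp only [k]
    split_ifs with hz
    · have hS : marginal P (below p i.val) x = 0 :=
        le_antisymm (hz ▸ marginal_anti h0 (hsub i)) (marginal_nonneg h0)
      rw [hS, mul_zero]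
      refine le_antisymm (hz ▸ marginal_anti h0 ((hsub i).trans ?_)) (marginal_nonneg h0)
      rw [below_succ]
      exact subset_insert _ _
    · rw [update_eq_self, div_mul_eq_mul_div, eq_div_iff hz, hci]
  have hprod : ∀ n, n ≤ p → ∀ x, marginal P (below p n) x = ∏ i ∈ below p n, k i (x i) x := by
    intro n hn
    induction n with
    | zero => intro x; rw [below_zero, marginal_empty, h1, prod_empty]
    | succ n ih =>
      intro x
      rw [hstep ⟨n, hn⟩ x, show below p (n + 1) = insert ⟨n, hn⟩ (below p n) from
        below_succ ⟨n, hn⟩, prod_insert (notMem_below ⟨n, hn⟩), ih (Nat.le_of_succ_le hn)]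
  refine ⟨k, fun i a x => ?_, fun i x => ?_, fun i a x y hxy => ?_, fun x => ?_⟩
  · dsimp only [k]
    split_ifs
    · positivity
    · exact div_nonneg (marginal_nonneg h0) (marginal_nonneg h0)
  · dsimp only [k]
    split_ifs with hz
    · simp
    · rw [← sum_div, sum_marginal_insert (hi i), div_self hz]
  · have hxy' : ∀ j ∈ boundary H i, x j = y j := hxy
    have : marginal P (insert i (boundary H i)) (update x i a) =
        marginal P (insert i (boundary H i)) (update y i a) := by
      refine marginal_congr fun j hj => ?_
      rcases mem_insert.1 hj with rfl | hj
      · simp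
      · rw [update_of_ne (ne_of_mem_of_not_mem hj (hi i)),
          update_of_ne (ne_of_mem_of_not_mem hj (hi i)), hxy' j hj]
    dsimp only [k]
    rw [this, marginal_congr hxy']
  · rw [← marginal_univ (P := P), ← below_length, hprod p le_rfl]

/-- Both products of marginals are sums over pairs `(y, z)`. Exchanging the coordinates in `W`
between `y` and `z` is an involution that carries one index set to the other. -/
theorem condIndep_of_swap {P : ((i : Fin p) → α i) → ℝ} {s t c W : Finset (Fin p)}
    (ht : t ⊆ W) (hs : Disjoint s W) (hc : Disjoint c W)
    (h : ∀ y z, (∀ j ∈ c, y j = z j) →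
      P y * P z = P (W.piecewise z y) * P (W.piecewise y z)) : CondIndep P s t c := by
  classical
  intro x
  have hs' : ∀ j ∈ s, j ∉ W := fun j hj => disjoint_left.1 hs hj
  have hc' : ∀ j ∈ c, j ∉ W := fun j hj => disjoint_left.1 hc hj
  simp only [marginal, sum_mul_sum, ← sum_product']
  refine sum_nbij' (fun q => (W.piecewise q.2 q.1, W.piecewise q.1 q.2))
    (fun q => (W.piecewise q.2 q.1, W.piecewise q.1 q.2)) ?_ ?_ ?_ ?_ ?_
  · rintro ⟨y, z⟩ hyz
    simp only [mem_product, mem_filter, mem_univ, true_and, mem_union] at hyz ⊢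
    obtain ⟨hy, hz⟩ := hyz
    constructor
    · rintro j (hj | hj)
      · rw [piecewise_eq_of_notMem _ _ _ (hs' j hj), hy j (by simp [hj])]
      · rw [piecewise_eq_of_notMem _ _ _ (hc' j hj), hy j (by simp [hj])]
    · rintro j (hj | hj)
      · rw [piecewise_eq_of_mem _ _ _ (ht hj), hy j (by simp [hj])]
      · rw [piecewise_eq_of_notMem _ _ _ (hc' j hj), hz j hj]
  · rintro ⟨y, z⟩ hyz
    simp only [mem_product, mem_filter, mem_univ, true_and, mem_union] at hyz ⊢
    obtain ⟨hy, hz⟩ := hyz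
    constructor
    · rintro j ((hj | hj) | hj)
      · rw [piecewise_eq_of_notMem _ _ _ (hs' j hj), hy j (by simp [hj])]
      · rw [piecewise_eq_of_mem _ _ _ (ht hj), hz j (by simp [hj])]
      · rw [piecewise_eq_of_notMem _ _ _ (hc' j hj), hy j (by simp [hj])]
    · intro j hj
      rw [piecewise_eq_of_notMem _ _ _ (hc' j hj), hz j (by simp [hj])]
  · rintro ⟨y, z⟩ -
    ext j <;> by_cases hj : j ∈ W <;> simp [hj]
  · rintro ⟨y, z⟩ -
    ext j <;> by_cases hj : j ∈ W <;> simp [hj]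
  · rintro ⟨y, z⟩ hyz
    simp only [mem_product, mem_filter, mem_univ, true_and, mem_union] at hyz
    exact h y z fun j hj => by rw [hyz.1 j (by simp [hj]), hyz.2 j hj]

/-- If the variables with index in a connected set `D` are copies of one binary variable and all
other variables are independent and uniform, the distribution is Markov. -/
theorem exists_mem_undirectedModel_copies {D : Finset (Fin p)}
    (hD : ∀ u ∈ D, ∀ v ∈ D, ∃ w : H.Walk u v, ∀ z ∈ w.support, z ∈ D)
    {a b : (i : Fin p) → α i} (hab : ∀ j ∈ D, a j ≠ b j) :
    ∃ P ∈ undirectedModel α H, (∀ x, 0 ≤ P x) ∧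
      ∀ x, P x ≠ 0 ↔ (∀ j ∈ D, x j = a j) ∨ ∀ j ∈ D, x j = b j := by
  classical
  let T : Finset ((i : Fin p) → α i) :=
    univ.filter fun x => (∀ j ∈ D, x j = a j) ∨ ∀ j ∈ D, x j = b j
  have memT : ∀ x, x ∈ T ↔ (∀ j ∈ D, x j = a j) ∨ ∀ j ∈ D, x j = b j := by simp [T]
  have hT : (T.card : ℝ) ≠ 0 := by
    rw [Nat.cast_ne_zero, card_ne_zero]
    exact ⟨a, (memT a).2 (Or.inl fun _ _ => rfl)⟩
  let P : ((i : Fin p) → α i) → ℝ := fun x => if x ∈ T then (T.card : ℝ)⁻¹ else 0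
  have hP0 : ∀ x, 0 ≤ P x := by
    intro x
    dsimp only [P]
    split_ifs <;> positivity
  have hmul : ∀ x y, P x * P y =
      if x ∈ T ∧ y ∈ T then (T.card : ℝ)⁻¹ * (T.card : ℝ)⁻¹ else 0 := by
    intro x y
    by_cases hx : x ∈ T <;> by_cases hy : y ∈ T <;> simp only [P, hx, hy, if_true, if_false,
      and_true, and_false, mul_zero, zero_mul]
  refine ⟨P, ⟨⟨hP0, ?_⟩, ?_⟩, hP0, fun x => ?_⟩
  · simp [P, hT]
  · intro s t c hst hsc htc hsep
    -- swapping blocks that are unions of `D`-compatible pieces preserves the support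
    have key : ∀ W : Finset (Fin p), t ⊆ W → Disjoint s W → Disjoint c W →
        (∀ y z, (∀ j ∈ c, y j = z j) → y ∈ T → z ∈ T →
          W.piecewise z y ∈ T ∧ W.piecewise y z ∈ T) → CondIndep P s t c := by
      intro W h1 h2 h3 h
      refine condIndep_of_swap h1 h2 h3 fun y z hyz => ?_
      -- `P` is uniform on `T`, so only membership matters; since the swap is an involution, one
      -- implication suffices.
      have hiff : (y ∈ T ∧ z ∈ T) ↔ (W.piecewise z y ∈ T ∧ W.piecewise y z ∈ T) := by
        refine ⟨fun hT => h y z hyz hT.1 hT.2, fun hT => ?_⟩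
        have := h (W.piecewise z y) (W.piecewise y z) (fun j hj => by
          rw [piecewise_eq_of_notMem _ _ _ (disjoint_left.1 h3 hj),
            piecewise_eq_of_notMem _ _ _ (disjoint_left.1 h3 hj), hyz j hj]) hT.1 hT.2
        have e1 : W.piecewise (W.piecewise y z) (W.piecewise z y) = y := by
          ext j; by_cases hj : j ∈ W <;> simp [hj]
        have e2 : W.piecewise (W.piecewise z y) (W.piecewise y z) = z := by
          ext j; by_cases hj : j ∈ W <;> simp [hj]
        rwa [e1, e2] at this
      rw [hmul, hmul]
      exact if_congr hiff rfl rfl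
    have hpw : ∀ (W : Finset (Fin p)) (y z : (i : Fin p) → α i), (∀ j ∈ D, y j = z j) →
        y ∈ T → W.piecewise z y ∈ T := by
      intro W y z hyz hy
      have : ∀ j ∈ D, W.piecewise z y j = y j := by
        intro j hj
        by_cases hjW : j ∈ W <;> simp [hjW, hyz j hj]
      rw [memT] at hy ⊢
      exact hy.imp (fun h j hj => (this j hj).trans (h j hj))
        (fun h j hj => (this j hj).trans (h j hj))
    have hdisj : ∀ (W : Finset (Fin p)) (y z : (i : Fin p) → α i), Disjoint D W →
        y ∈ T → W.piecewise z y ∈ T := by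
      intro W y z hW hy
      have : ∀ j ∈ D, W.piecewise z y j = y j := fun j hj =>
        piecewise_eq_of_notMem _ _ _ (disjoint_left.1 hW hj)
      rw [memT] at hy ⊢
      exact hy.imp (fun h j hj => (this j hj).trans (h j hj))
        (fun h j hj => (this j hj).trans (h j hj))
    have hsubs : ∀ (W : Finset (Fin p)) (y z : (i : Fin p) → α i), D ⊆ W →
        z ∈ T → W.piecewise z y ∈ T := by
      intro W y z hW hz
      have : ∀ j ∈ D, W.piecewise z y j = z j := fun j hj =>
        piecewise_eq_of_mem _ _ _ (hW hj)
      rw [memT] at hz ⊢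
      exact hz.imp (fun h j hj => (this j hj).trans (h j hj))
        (fun h j hj => (this j hj).trans (h j hj))
    -- If `c` misses `D`, then `D` cannot meet both `s` and `t`, as a walk inside `D` would avoid
    -- `c`; so `D` can be kept whole, either outside or inside `W`.
    by_cases hDc : Disjoint D c
    · by_cases hDt : Disjoint D t
      · exact key t subset_rfl hst htc.symm fun y z _ hy hz =>
          ⟨hdisj t y z hDt hy, hdisj t z y hDt hz⟩
      · have hDs : Disjoint D s := by
          rw [disjoint_left]
          intro u huD hus
          obtain ⟨v, hvD, hvt⟩ := not_disjoint_iff.1 hDt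
          obtain ⟨w, hw⟩ := hD u huD v hvD
          obtain ⟨j, hjc, hjw⟩ := hsep u hus v hvt w
          exact disjoint_left.1 hDc (hw j hjw) hjc
        exact key (t ∪ D) subset_union_left (disjoint_union_right.2 ⟨hst, hDs.symm⟩)
          (disjoint_union_right.2 ⟨htc.symm, hDc.symm⟩) fun y z _ hy hz =>
          ⟨hsubs _ y z subset_union_right hz, hsubs _ z y subset_union_right hy⟩
    -- A common value at `d` reveals which of the two patterns holds, so `y` and `z` agree on all of
    -- `D`.
    · obtain ⟨d, hdD, hdc⟩ := not_disjoint_iff.1 hDc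
      refine key t subset_rfl hst htc.symm fun y z hyz hy hz => ?_
      have hagree : ∀ j ∈ D, y j = z j := by
        have hd := hyz d hdc
        rcases (memT y).1 hy with hy | hy <;> rcases (memT z).1 hz with hz | hz
        · exact fun j hj => (hy j hj).trans (hz j hj).symm
        · exact absurd ((hy d hdD).symm.trans (hd.trans (hz d hdD))) (hab d hdD)
        · exact absurd ((hz d hdD).symm.trans (hd.symm.trans (hy d hdD))) (hab d hdD)
        · exact fun j hj => (hy j hj).trans (hz j hj).symm
      exact ⟨hpw t y z hagree hy, hpw t z y (fun j hj => (hagree j hj).symm) hz⟩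
  · rw [← memT]
    dsimp only [P]
    split_ifs with h <;> simp [h, hT]

theorem walk_support_connected {i j : Fin p} (w : H.Walk i j) {u v : Fin p}
    (hu : u ∈ w.support) (hv : v ∈ w.support) :
    ∃ w' : H.Walk u v, ∀ z ∈ w'.support, z ∈ w.support := by
  classical
  refine ⟨(w.takeUntil u hu).reverse.append (w.takeUntil v hv), fun z hz => ?_⟩
  rw [SimpleGraph.Walk.mem_support_append_iff, SimpleGraph.Walk.support_reverse,
    List.mem_reverse] at hz
  rcases hz with hz | hz
  · exact w.support_takeUntil_subset_support hu hz
  · exact w.support_takeUntil_subset_support hv hz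

/-- If `x` and `y` differ at a boundary vertex `j`, let the variables along a walk from `i` to `j`
be copies of each other. Only `j` among them precedes `i`, so both pasts have positive probability,
yet they force different values of variable `i`. -/
theorem agreeOn_boundary_iff [∀ i, Nontrivial (α i)] (H : SimpleGraph (Fin p)) (i : Fin p)
    (x y : (i : Fin p) → α i) :
    agreeOn α (boundary H i : Set (Fin p)) x y ↔
      ∀ P ∈ undirectedModel α H, SameConditional P i x y := by
  classical
  constructor
  · intro h P hP
    exact sameConditional_of_mem (r := fun i => agreeOn α (boundary H i : Set (Fin p)))
      (fun i x y hxy j hj => hxy j (lt_of_mem_boundary hj))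
      (undirectedModel_subset_kernelModel H hP) h
  · intro h j hj
    by_contra hne
    obtain ⟨hji, w, hw⟩ := mem_boundary.1 hj
    choose u v huv using fun m => exists_pair_ne (α m)
    -- The two patterns extend the pasts of `x` and `y`; from `i` on, any two distinct values will
    -- do.
    let a : (m : Fin p) → α m := fun m => if m < i then x m else u m
    let b : (m : Fin p) → α m := fun m => if m < i then y m else v m
    have hab : ∀ m ∈ w.support.toFinset, a m ≠ b m := by
      intro m hm
      rw [List.mem_toFinset] at hm
      rcases hw m hm with rfl | hm
      · simpa [a, b, hji] using hne
      · simpa [a, b, not_lt.2 hm] using huv m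
    obtain ⟨P, hP, h0, hsupp⟩ := exists_mem_undirectedModel_copies (H := H) (fun u hu v hv => by
      simp only [List.mem_toFinset] at hu hv ⊢
      exact walk_support_connected w hu hv) hab
    have hPa : 0 < P a := (h0 a).lt_of_ne' ((hsupp a).2 (Or.inl fun _ _ => rfl))
    have hPb : 0 < P b := (h0 b).lt_of_ne' ((hsupp b).2 (Or.inr fun _ _ => rfl))
    have h1 : 0 < marginal P (insert i (below p i)) (update x i (a i)) := by
      refine hPa.trans_le (le_marginal h0 fun m hm => ?_)
      rcases mem_insert.1 hm with rfl | hm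
      · simp
      · rw [update_of_ne (ne_of_mem_of_not_mem hm (notMem_below i))]
        exact if_pos (by simpa using hm)
    have h2 : 0 < marginal P (below p i) y :=
      hPb.trans_le (le_marginal h0 fun m hm => if_pos (by simpa using hm))
    have h3 : marginal P (insert i (below p i)) (update y i (a i)) = 0 := by
      unfold marginal
      refine sum_eq_zero fun z hz => ?_
      rw [mem_filter] at hz
      have hzj : z j = y j := by
        rw [hz.2 j (mem_insert_of_mem (by simpa using hji)), update_of_ne hji.ne]
      have hzi : z i = a i := by
        rw [hz.2 i (mem_insert_self _ _), update_self]
      have hyb : y j = b j := (if_pos hji).symm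
      by_contra hPz
      rcases (hsupp z).1 hPz with hz' | hz'
      · have hj' : j ∈ w.support.toFinset := by simp
        exact hab j hj' ((hz' j hj').symm.trans (hzj.trans hyb))
      · have hi' : i ∈ w.support.toFinset := by simp
        exact hab i hi' (hzi.symm.trans (hz' i hi'))
    have := h P hP (a i)
    rw [h3, zero_mul] at this
    exact (mul_pos h1 h2).ne' this

/-- The easy direction of Hammersley–Clifford, valid without positivity: each factor depends only on
the variables of a clique, and a clique cannot straddle a separation. -/
theorem kernelModel_subset_undirectedModel [∀ i, Nonempty (α i)] {B : Fin p → Finset (Fin p)}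
    (hlt : ∀ i, ∀ j ∈ B i, j < i) (hH : ∀ i, H.IsClique (insert i (B i) : Finset (Fin p))) :
    kernelModel (fun i => agreeOn α (B i : Set (Fin p))) ⊆ undirectedModel α H := by
  classical
  rintro P ⟨k, h0, h1, hk, hP⟩
  have hk' : ∀ i a x y, (∀ j < i, x j = y j) → k i a x = k i a y :=
    fun i a x y h => hk i a x y fun j hj => h j (hlt i j hj)
  refine ⟨⟨fun x => ?_, ?_⟩, fun s t c hst hsc htc hsep => ?_⟩
  · rw [hP]
    exact prod_nonneg fun i _ => h0 i _ _
  · have := marginal_below h1 hk' hP (Nat.zero_le p) Classical.ofNonempty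
    rwa [below_zero, marginal_empty, prod_empty] at this
  -- `U` is what can be reached from `s` without meeting `c`; the coordinates outside `U ∪ c` get
  -- swapped.
  · let U : Finset (Fin p) := univ.filter fun v =>
      ∃ u ∈ s, ∃ w : H.Walk u v, ∀ z ∈ w.support, z ∉ c
    have memU : ∀ v, v ∈ U ↔ ∃ u ∈ s, ∃ w : H.Walk u v, ∀ z ∈ w.support, z ∉ c := by simp [U]
    refine condIndep_of_swap (W := univ \ (U ∪ c)) (fun v hv => ?_) ?_ ?_ fun y z hyz => ?_
    · simp only [mem_sdiff, mem_univ, true_and, mem_union, not_or]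
      refine ⟨fun hU => ?_, disjoint_left.1 htc hv⟩
      obtain ⟨u, hu, w, hw⟩ := (memU v).1 hU
      obtain ⟨j, hjc, hj⟩ := hsep u hu v hv w
      exact hw j hj hjc
    · refine disjoint_left.2 fun v hv hv' => (mem_sdiff.1 hv').2 (mem_union_left _ ?_)
      exact (memU v).2 ⟨v, hv, .nil, by simpa using disjoint_left.1 hsc hv⟩
    · exact disjoint_left.2 fun v hv hv' => (mem_sdiff.1 hv').2 (mem_union_right _ hv)
    · simp only [hP, ← prod_mul_distrib]
      refine prod_congr rfl fun i _ => ?_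
      set W := univ \ (U ∪ c) with hW
      have hcongr : ∀ y z : (j : Fin p) → α j, (∀ j ∈ insert i (B i), y j = z j) →
          k i (y i) y = k i (z i) z := by
        intro y z h
        rw [h i (mem_insert_self _ _)]
        exact hk i _ _ _ fun j hj => h j (mem_insert_of_mem hj)
      -- A clique that misses `W` keeps its two factors. One that meets `W` misses `U`, so, as `y =
      -- z` on `c`, its two factors are interchanged.
      by_cases hU : Disjoint (insert i (B i)) W
      · rw [hcongr (W.piecewise z y) y fun j hj =>
            piecewise_eq_of_notMem _ _ _ (disjoint_left.1 hU hj),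
          hcongr (W.piecewise y z) z fun j hj =>
            piecewise_eq_of_notMem _ _ _ (disjoint_left.1 hU hj)]
      · obtain ⟨b, hbC, hbW⟩ := not_disjoint_iff.1 hU
        have hCU : ∀ j ∈ insert i (B i), j ∉ U := by
          intro j hj hjU
          obtain ⟨u, hu, w, hw⟩ := (memU j).1 hjU
          have hb : b ∉ U ∧ b ∉ c := by simpa [hW] using hbW
          have hadj : H.Adj j b := hH i hj hbC fun h => hb.1 (h ▸ hjU)
          refine hb.1 ((memU b).2 ⟨u, hu, w.concat hadj, fun z hz => ?_⟩)
          rw [SimpleGraph.Walk.support_concat, List.mem_append, List.mem_singleton] at hz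
          rcases hz with hz | rfl
          · exact hw z hz
          · exact hb.2
        have hpw : ∀ y z : (j : Fin p) → α j, (∀ j ∈ c, y j = z j) →
            ∀ j ∈ insert i (B i), W.piecewise z y j = z j := by
          intro y z hyz j hj
          by_cases hjW : j ∈ W
          · exact piecewise_eq_of_mem _ _ _ hjW
          · rw [piecewise_eq_of_notMem _ _ _ hjW]
            refine hyz j ?_
            by_contra hjc
            exact hjW (by simp [hW, hjc, hCU j hj])
        rw [hcongr _ _ (hpw y z hyz), hcongr _ _ (hpw z y fun j hj => (hyz j hj).symm), mul_comm]

/-- The vertex `u ≥ i` from which the walk first steps to `j` has `j ∈ B u`, since edges of `H` come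
from `B` and `j < u`; `hB` carries this down to `i`. -/
theorem boundary_subset {B : Fin p → Finset (Fin p)}
    (hH : ∀ i j, H.Adj i j → i ∈ B j ∨ j ∈ B i)
    (hB : ∀ i m j, i ≤ m → j < i → j ∈ B m → j ∈ B i) (hlt : ∀ i, ∀ j ∈ B i, j < i) (i : Fin p) :
    boundary H i ⊆ B i := by
  intro j hj
  obtain ⟨hji, w, hw⟩ := mem_boundary.1 hj
  have : ∀ {u : Fin p} (w : H.Walk u j), (∀ v ∈ w.support, v = j ∨ i ≤ v) → i ≤ u → j ∈ B i := by
    intro u w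
    induction w with
    | nil => exact fun _ h => absurd h (not_le.2 hji)
    | @cons u u' j h w ih =>
      intro hw hu
      rcases hw u' (by simp) with rfl | hu'
      · rcases hH _ _ h with h | h
        · exact absurd (hlt _ _ h) (not_lt.2 (hji.le.trans hu))
        · exact hB i u _ hu hji h
      · exact ih hj hji ‹_› ‹_› (fun v hv => hw v (by simp [hv])) hu'
  exact this w hw le_rfl

/-- The undirected graph in which `j < i` are adjacent if `j ∈ B i`. -/
def skeleton (B : Fin p → Finset (Fin p)) : SimpleGraph (Fin p) :=
  SimpleGraph.fromRel fun i j => i ∈ B j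

theorem skeleton_adj {B : Fin p → Finset (Fin p)} {i j : Fin p} :
    (skeleton B).Adj i j ↔ i ≠ j ∧ (i ∈ B j ∨ j ∈ B i) := by
  simp [skeleton]

theorem kernelModel_eq_undirectedModel [∀ i, Nonempty (α i)] {B : Fin p → Finset (Fin p)}
    (hB : ∀ i m j, i ≤ m → j < i → j ∈ B m → j ∈ B i) (hlt : ∀ i, ∀ j ∈ B i, j < i) :
    kernelModel (fun i => agreeOn α (B i : Set (Fin p))) = undirectedModel α (skeleton B) := by
  refine (kernelModel_subset_undirectedModel hlt fun i u hu v hv huv => ?_).antisymm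
    ((undirectedModel_subset_kernelModel _).trans (kernelModel_mono fun i x y hxy j hj =>
      hxy j (boundary_subset (fun i j h => (skeleton_adj.1 h).2) hB hlt i hj)))
  rw [skeleton_adj]
  refine ⟨huv, ?_⟩
  rw [mem_coe, mem_insert] at hu hv
  rcases hu with rfl | hu <;> rcases hv with rfl | hv
  · exact absurd rfl huv
  · exact Or.inr hv
  · exact Or.inl hu
  · rcases lt_or_gt_of_ne huv with h | h
    · exact Or.inl (hB v i u (hlt _ _ hv).le h hu)
    · exact Or.inr (hB u i v (hlt _ _ hu).le h hv)

end MarkovNetworks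

/-! ### Paths in a directed multigraph -/

section Paths

variable {V E : Type*} {src tgt : E → V}

theorem isPath_zero {e : Fin 0 → E} {u w : V} : IsPath src tgt e u w ↔ u = w := by
  constructor
  · rintro ⟨v, rfl, rfl, -⟩
    rfl
  · rintro rfl
    exact ⟨fun _ => u, rfl, rfl, fun j => j.elim0⟩

theorem isPath_snoc {n : ℕ} {e : Fin n → E} {f : E} {u w : V} :
    IsPath src tgt (Fin.snoc e f : Fin (n + 1) → E) u w ↔
      IsPath src tgt e u (src f) ∧ tgt f = w := by
  constructor
  · rintro ⟨v, rfl, rfl, h⟩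
    have hl := h (Fin.last n)
    rw [Fin.snoc_last] at hl
    refine ⟨⟨fun j => v j.castSucc, rfl, hl.1.symm, fun j => ?_⟩, hl.2⟩
    have hj := h j.castSucc
    rwa [Fin.snoc_castSucc] at hj
  · rintro ⟨⟨v, h0, hl, h⟩, rfl⟩
    refine ⟨Fin.snoc (α := fun _ => V) v (tgt f), ?_, Fin.snoc_last .., fun j => ?_⟩
    · rw [← Fin.castSucc_zero, Fin.snoc_castSucc, h0]
    · induction j using Fin.lastCases with
      | last => simp [hl]
      | cast j =>
        rw [Fin.snoc_castSucc, Fin.snoc_castSucc, ← Fin.castSucc_succ, Fin.snoc_castSucc]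
        exact h j

theorem IsPath.exists_append {n m : ℕ} {e : Fin n → E} {f : Fin m → E} {u v w : V}
    (he : IsPath src tgt e u v) (hf : IsPath src tgt f v w) :
    ∃ g : Fin (n + m) → E, IsPath src tgt g u w := by
  induction m generalizing w with
  | zero =>
    rw [isPath_zero] at hf
    subst hf
    exact ⟨e, he⟩
  | succ m ih =>
    rw [← Fin.snoc_init_self f, isPath_snoc] at hf
    obtain ⟨g, hg⟩ := ih hf.1
    exact ⟨Fin.snoc (α := fun _ => E) g (f (Fin.last m)), isPath_snoc.2 ⟨hg, hf.2⟩⟩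

theorem IsPath.take {n m : ℕ} (hmn : m ≤ n) {e : Fin n → E} {u w : V}
    (h : IsPath src tgt e u w) : ∃ w', IsPath src tgt (fun l => e (Fin.castLE hmn l)) u w' ∧
      (∀ hm : m < n, src (e ⟨m, hm⟩) = w') ∧ (m = n → w' = w) := by
  obtain ⟨v, rfl, rfl, h⟩ := h
  refine ⟨v ⟨m, by omega⟩, ⟨fun j => v (Fin.castLE (by omega) j), rfl, rfl, fun j => ?_⟩,
    fun hm => (h ⟨m, hm⟩).1, ?_⟩
  · exact h (Fin.castLE hmn j)
  · rintro rfl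
    rfl

theorem IsPath.tgt_eq_src {n : ℕ} {e : Fin n → E} {u w : V} (h : IsPath src tgt e u w) {j : ℕ}
    (hj : j + 1 < n) : tgt (e ⟨j, Nat.lt_of_succ_lt hj⟩) = src (e ⟨j + 1, hj⟩) := by
  obtain ⟨v, -, -, h⟩ := h
  exact (h ⟨j, _⟩).2.trans (h ⟨j + 1, hj⟩).1.symm

end Paths

/-! ### Levels of an automaton -/

namespace APFA

variable {V E S : Type*} {p : ℕ} (A : APFA V E S p)

section Levels

variable {A}

theorem eq_of_isPath {n : ℕ} {e f : Fin n → E} {u w w' : V} (he : IsPath A.src A.tgt e u w)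
    (hf : IsPath A.src A.tgt f u w') (h : ∀ j, A.sym (e j) = A.sym (f j)) :
    e = f ∧ w = w' := by
  induction n generalizing w w' with
  | zero => exact ⟨Subsingleton.elim _ _, (isPath_zero.1 he).symm.trans (isPath_zero.1 hf)⟩
  | succ n ih =>
    rw [← Fin.snoc_init_self e, isPath_snoc] at he
    rw [← Fin.snoc_init_self f, isPath_snoc] at hf
    obtain ⟨h1, h2⟩ := ih he.1 hf.1 fun j => h j.castSucc
    have h3 := A.deterministic _ _ h2 (h (Fin.last n))
    refine ⟨?_, by rw [← he.2, ← hf.2, h3]⟩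
    rw [← Fin.snoc_init_self e, ← Fin.snoc_init_self f, h1, h3]

/-- One fixed path to the sink completes every root-to-`v` path to length `p`. This makes levels
unique and bounded by `p`. -/
theorem exists_isPath_sink (v : V) :
    ∃ (n : ℕ) (e : Fin n → E), IsPath A.src A.tgt e v A.sink ∧ ∀ j, A.IsLevel j v → j + n = p := by
  obtain ⟨n, e, he⟩ := A.to_sink v
  refine ⟨n, e, he, fun j hj => ?_⟩
  obtain ⟨f, hf⟩ := hj
  obtain ⟨g, hg⟩ := hf.exists_append he
  exact A.length_eq _ g hg

theorem IsLevel.le {i : ℕ} {v : V} (h : A.IsLevel i v) : i ≤ p := by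
  obtain ⟨n, e, -, hn⟩ := exists_isPath_sink (A := A) v
  have := hn i h
  omega

theorem IsLevel.unique {i j : ℕ} {v : V} (hi : A.IsLevel i v) (hj : A.IsLevel j v) : i = j := by
  obtain ⟨n, e, -, hn⟩ := exists_isPath_sink (A := A) v
  have := hn i hi
  have := hn j hj
  omega

theorem IsLevel.eq_sink {v : V} (h : A.IsLevel p v) : v = A.sink := by
  obtain ⟨n, e, he, hn⟩ := exists_isPath_sink (A := A) v
  obtain rfl : n = 0 := by
    have := hn p h
    omega
  exact isPath_zero.1 he

theorem IsLevel.lt_of_src {i : ℕ} {e : E} (h : A.IsLevel i (A.src e)) : i < p :=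
  h.le.lt_of_ne fun hp => A.src_ne_sink e (hp ▸ h).eq_sink

theorem IsLevel.tgt {i : ℕ} {e : E} (h : A.IsLevel i (A.src e)) : A.IsLevel (i + 1) (A.tgt e) := by
  obtain ⟨f, hf⟩ := h
  exact ⟨_, isPath_snoc.2 ⟨hf, rfl⟩⟩

theorem exists_isLevel (v : V) : ∃ i, A.IsLevel i v := A.root_to v

theorem isLevel_of_isPath {n : ℕ} {e : Fin n → E} {w : V} (h : IsPath A.src A.tgt e A.root w)
    (j : Fin n) : A.IsLevel j (A.src (e j)) := by
  obtain ⟨w', hw', heq, -⟩ := h.take j.2.le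
  exact ⟨_, heq j.2 ▸ hw'⟩

end Levels

/-! ### Runs of a complete automaton, its model as a kernel model, and property Q -/

variable [Fintype E] {A}

theorem sym_mem_sampleSpace {i : Fin p} {e : E} (h : A.IsLevel i (A.src e)) :
    A.sym e ∈ A.sampleSpace i := by
  classical
  exact mem_image_of_mem _ (by simpa using h.tgt)

/-- Outgoing symbols are distinct and lie in the sample space; completeness makes the cardinalities
equal, so all values occur. -/
theorem exists_edge (hA : A.IsComplete) {i : Fin p} {v : V} (hv : A.IsLevel i v) {a : S}
    (ha : a ∈ A.sampleSpace i) : ∃ e, A.src e = v ∧ A.sym e = a := by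
  classical
  have hsub : (univ.filter fun e => A.src e = v).image A.sym ⊆ A.sampleSpace i := by
    intro s hs
    obtain ⟨e, he, rfl⟩ := mem_image.1 hs
    rw [mem_filter] at he
    exact sym_mem_sampleSpace (he.2.symm ▸ hv)
  have hcard : (A.sampleSpace i).card ≤ ((univ.filter fun e => A.src e = v).image A.sym).card := by
    have hinj : Set.InjOn A.sym (univ.filter fun e => A.src e = v : Finset E) := by
      intro e he f hf hef
      rw [mem_coe, mem_filter] at he hf
      exact A.deterministic e f (he.2.trans hf.2.symm) hef
    rw [card_image_of_injOn hinj, ← hA i v hv]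
  rw [← eq_of_subset_of_card_le hsub hcard] at ha
  obtain ⟨e, he, rfl⟩ := mem_image.1 ha
  exact ⟨e, (mem_filter.1 he).2, rfl⟩

theorem exists_run (hA : A.IsComplete) (x : (i : Fin p) → A.sampleSpace i) :
    ∃ e : Fin p → E, IsPath A.src A.tgt e A.root A.sink ∧ ∀ i, A.sym (e i) = x i := by
  have : ∀ n (hn : n ≤ p), ∃ (w : V) (e : Fin n → E), IsPath A.src A.tgt e A.root w ∧
      ∀ i, A.sym (e i) = x (Fin.castLE hn i) := by
    intro n hn
    induction n with
    | zero => exact ⟨A.root, Fin.elim0, isPath_zero.2 rfl, fun i => i.elim0⟩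
    | succ n ih =>
      obtain ⟨w, e, he, hx⟩ := ih (Nat.le_of_succ_le hn)
      obtain ⟨f, rfl, hf⟩ := exists_edge hA (i := ⟨n, hn⟩) ⟨e, he⟩ (x ⟨n, hn⟩).2
      refine ⟨A.tgt f, Fin.snoc (α := fun _ => E) e f, isPath_snoc.2 ⟨he, rfl⟩, fun i => ?_⟩
      induction i using Fin.lastCases with
      | last => rw [Fin.snoc_last]; exact hf
      | cast i => rw [Fin.snoc_castSucc]; exact hx i
  obtain ⟨w, e, he, hx⟩ := this p le_rfl
  obtain rfl := IsLevel.eq_sink ⟨e, he⟩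
  exact ⟨e, he, hx⟩

/-- The root-to-sink path with symbol string `x` of a complete automaton. -/
noncomputable def run (hA : A.IsComplete) (x : (i : Fin p) → A.sampleSpace i) : Fin p → E :=
  (exists_run hA x).choose

variable (hA : A.IsComplete) {x y : (i : Fin p) → A.sampleSpace i}

theorem isPath_run (x : (i : Fin p) → A.sampleSpace i) :
    IsPath A.src A.tgt (run hA x) A.root A.sink :=
  (exists_run hA x).choose_spec.1

theorem sym_run (x : (i : Fin p) → A.sampleSpace i) (i : Fin p) : A.sym (run hA x i) = x i :=
  (exists_run hA x).choose_spec.2 i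

theorem isLevel_run (x : (i : Fin p) → A.sampleSpace i) (i : Fin p) :
    A.IsLevel i (A.src (run hA x i)) :=
  isLevel_of_isPath (isPath_run hA x) i

theorem run_of_isPath {n : ℕ} (hn : n ≤ p) {f : Fin n → E} {w : V}
    (hf : IsPath A.src A.tgt f A.root w) (h : ∀ j, (x (Fin.castLE hn j) : S) = A.sym (f j)) :
    (∀ j, run hA x (Fin.castLE hn j) = f j) ∧ ∀ hn' : n < p, A.src (run hA x ⟨n, hn'⟩) = w := by
  obtain ⟨w', hw', h1, -⟩ := (isPath_run hA x).take hn
  obtain ⟨h2, rfl⟩ := eq_of_isPath hw' hf fun j => by rw [sym_run, h]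
  exact ⟨fun j => congrFun h2 j, h1⟩

theorem exists_run_extends [∀ i, Nonempty (A.sampleSpace i)] {n : ℕ} (hn : n ≤ p) {f : Fin n → E}
    {w : V} (hf : IsPath A.src A.tgt f A.root w) : ∃ x,
    (∀ j, run hA x (Fin.castLE hn j) = f j) ∧ ∀ hn' : n < p, A.src (run hA x ⟨n, hn'⟩) = w := by
  classical
  refine ⟨fun j => if h : j.val < n then ⟨A.sym (f ⟨j, h⟩), sym_mem_sampleSpace
    (isLevel_of_isPath hf ⟨j, h⟩)⟩ else Classical.ofNonempty, run_of_isPath hA hn hf fun j => ?_⟩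
  simp

theorem exists_run_eq [∀ i, Nonempty (A.sampleSpace i)] (e : E) : ∃ x i, run hA x i = e := by
  obtain ⟨i, f, hf⟩ := A.exists_isLevel (A.src e)
  have hi : i < p := IsLevel.lt_of_src ⟨f, hf⟩
  obtain ⟨x, hx, -⟩ := exists_run_extends hA (n := i + 1) hi (isPath_snoc.2 ⟨hf, rfl⟩)
  have hlast := hx (Fin.last i)
  rw [Fin.snoc_last] at hlast
  exact ⟨x, ⟨i, hi⟩, hlast⟩

/-- Two strings are equivalent at `i` if they lead to the same state at level `i`. -/
noncomputable def stateRel (i : Fin p) : Setoid ((i : Fin p) → A.sampleSpace i) :=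
  Setoid.ker fun x => A.src (run hA x i)

theorem stateRel_iff {i : Fin p} :
    stateRel hA i x y ↔ A.src (run hA x i) = A.src (run hA y i) := Iff.rfl

theorem causal_stateRel : Causal (stateRel hA) := by
  intro i x y h
  obtain ⟨w, hw, h1, -⟩ := (isPath_run hA y).take i.2.le
  refine ((run_of_isPath hA i.2.le hw fun j => ?_).2 i.2).trans (h1 i.2).symm
  rw [h _ (show Fin.castLE i.2.le j < i from j.2), sym_run]

theorem run_congr {i : Fin p} (h : stateRel hA i x y) (hi : x i = y i) :
    run hA x i = run hA y i :=
  A.deterministic _ _ h (by rw [sym_run, sym_run, hi])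

/-- Merged runs stay merged while they read equal symbols. General Bayesian networks lack this; it
yields the monotonicity needed for the undirected model. -/
theorem stateRel_of_le {i m : Fin p} (him : i ≤ m) (h : stateRel hA i x y)
    (hxy : ∀ l, i ≤ l → l < m → x l = y l) : stateRel hA m x y := by
  obtain ⟨i, hi⟩ := i
  obtain ⟨m, hm⟩ := m
  have him' : i ≤ m := him
  induction m, him' using Nat.le_induction with
  | base => exact h
  | succ m hle ih =>
    have hm' : m < p := Nat.lt_of_succ_lt hm
    have ih' := ih hm' hle fun l h1 h2 => hxy l h1 (lt_trans h2 (Nat.lt_succ_self m))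
    have hrun := run_congr hA ih' (hxy ⟨m, hm'⟩ hle (Nat.lt_succ_self m))
    rw [stateRel_iff, ← (isPath_run hA x).tgt_eq_src hm, ← (isPath_run hA y).tgt_eq_src hm, hrun]

theorem src_run_update (i : Fin p) (a : A.sampleSpace i) :
    A.src (run hA (update x i a) i) = A.src (run hA x i) :=
  causal_stateRel hA i _ _ fun _ hj => update_of_ne hj.ne _ _

/-- Varying the symbol at `i` runs once through the edges leaving the current state, so
normalization of kernels and of edge probabilities match. -/
theorem sum_run_update [DecidableEq V] (g : E → ℝ) (x : (i : Fin p) → A.sampleSpace i)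
    (i : Fin p) : ∑ a, g (run hA (update x i a) i) = ∑ e with A.src e = A.src (run hA x i), g e := by
  refine sum_nbij (fun a => run hA (update x i a) i) (fun a _ => ?_) (fun a _ b _ hab => ?_)
    (fun e he => ?_) fun _ _ => rfl
  · simpa using src_run_update hA i a
  · have := congrArg A.sym hab
    rw [sym_run, sym_run, update_self, update_self] at this
    exact Subtype.ext this
  · have he' : A.src e = A.src (run hA x i) := by simpa using he
    refine ⟨⟨A.sym e, sym_mem_sampleSpace (he' ▸ isLevel_run hA x i)⟩, by simp, ?_⟩
    exact A.deterministic _ _ ((src_run_update hA i _).trans he'.symm) (by simp [sym_run])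

theorem pmf_eq (π : E → ℝ) (x : (i : Fin p) → A.sampleSpace i) :
    A.pmf π x = ∏ i, π (run hA x i) := by
  classical
  unfold pmf
  refine (sum_eq_single_of_mem (run hA x) ?_ fun e he hne => ?_)
  · simpa [sym_run] using isPath_run hA x
  · rw [mem_filter] at he
    exact absurd (eq_of_isPath he.2.1 (isPath_run hA x) fun j => by
      rw [sym_run, he.2.2]).1 hne

theorem model_eq_kernelModel [∀ i, Nonempty (A.sampleSpace i)] :
    A.model = kernelModel (stateRel hA) := by
  classical
  ext P
  constructor
  · rintro ⟨π, ⟨h0, h1⟩, rfl⟩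
    refine ⟨fun i a x => π (run hA (update x i a) i), fun _ _ _ => h0 _, fun i x => ?_,
      fun i a x y h => ?_, fun x => ?_⟩
    · rw [sum_run_update hA, ← h1 _ (A.src_ne_sink (run hA x i))]
    · refine congrArg π (run_congr hA ?_ (by simp))
      exact (src_run_update hA i a).trans (Eq.trans h (src_run_update hA i a).symm)
    · rw [pmf_eq hA]
      simp only [update_eq_self]
  · rintro ⟨k, h0, h1, hk, hP⟩
    -- Each edge gets a string whose run uses it. The choice is immaterial, because the edge fixes
    -- its level, symbol and source state, and `k` depends on no more.
    choose x i hxi using exists_run_eq hA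
    let π : E → ℝ := fun e => k (i e) (x e (i e)) (x e)
    have hπ : ∀ y j, π (run hA y j) = k j (y j) y := by
      intro y j
      have hrun := hxi (run hA y j)
      have hij : i (run hA y j) = j := by
        have h := isLevel_run hA (x (run hA y j)) (i (run hA y j))
        rw [hrun] at h
        exact Fin.ext (h.unique (isLevel_run hA y j))
      dsimp only [π]
      generalize x (run hA y j) = z at *
      generalize i (run hA y j) = l at *
      subst hij
      have hsym : z l = y l := Subtype.ext (by rw [← sym_run hA z, ← sym_run hA y, hrun])
      rw [hsym]
      exact hk l _ _ _ (congrArg A.src hrun)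
    refine ⟨π, ⟨fun e => h0 _ _ _, fun v hv => ?_⟩, ?_⟩
    · obtain ⟨n, f, hf⟩ := A.exists_isLevel v
      have hn : n < p := (IsLevel.le ⟨f, hf⟩).lt_of_ne (by
        rintro rfl
        exact hv (IsLevel.eq_sink ⟨f, hf⟩))
      obtain ⟨y, -, hy⟩ := exists_run_extends hA hn.le hf
      rw [← hy hn, ← h1 ⟨n, hn⟩ y]
      refine Eq.trans ?_ ((sum_run_update hA π y ⟨n, hn⟩).symm.trans ?_)
      · exact sum_congr (filter_congr_decidable ..) fun _ _ => rfl
      · refine sum_congr rfl fun a _ => ?_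
        rw [hπ, update_self]
        exact hk _ _ _ _ (src_run_update hA _ _)
    · ext y
      rw [pmf_eq hA, hP]
      exact prod_congr rfl fun j _ => (hπ y j).symm

theorem propertyQ_iff [∀ i, Nonempty (A.sampleSpace i)] :
    A.PropertyQ ↔ ∀ i : Fin p, ∃ B : Finset (Fin p), (∀ j ∈ B, j < i) ∧
      ∀ x y, stateRel hA i x y ↔ agreeOn (fun i => A.sampleSpace i) (B : Set (Fin p)) x y := by
  classical
  have hpre : ∀ (i : Fin p) x, IsPath A.src A.tgt (fun l => run hA x (Fin.castLE i.2.le l)) A.root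
      (A.src (run hA x i)) := by
    intro i x
    obtain ⟨w, hw, h1, -⟩ := (isPath_run hA x).take i.2.le
    exact (h1 i.2).symm ▸ hw
  have hsub : ∀ (i : Fin p) (B : Finset (Fin i)) (x y : (i : Fin p) → A.sampleSpace i),
      (A.subvector B (fun l => run hA x (Fin.castLE i.2.le l)) =
        A.subvector B (fun l => run hA y (Fin.castLE i.2.le l))) ↔
      ∀ j ∈ B, x (Fin.castLE i.2.le j) = y (Fin.castLE i.2.le j) := by
    intro i B x y
    rw [funext_iff, Subtype.forall]
    refine forall₂_congr fun j hj => ?_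
    rw [subvector, subvector, sym_run, sym_run, Subtype.coe_inj]
  constructor
  · intro hQ i
    -- Property Q is silent about level 0, where the root is the only state and the empty set works.
    rcases Nat.eq_zero_or_pos i.val with h0 | hpos
    · refine ⟨∅, by simp, fun x y => ⟨fun _ j hj => by simp at hj, fun _ => ?_⟩⟩
      exact causal_stateRel hA i x y fun j hj => by
        have : j.val < i.val := hj
        omega
    · obtain ⟨B, hB⟩ := hQ i hpos i.2
      refine ⟨B.map (Fin.castLEEmb i.2.le), ?_, fun x y => ?_⟩
      · intro j hj
        obtain ⟨l, -, rfl⟩ := mem_map.1 hj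
        exact l.2
      · obtain ⟨z, -, hz⟩ := hB _ (isLevel_run hA x i)
        have hx : (fun l => run hA x (Fin.castLE i.2.le l)) ∈
          A.pathsTo i (A.src (run hA x i)) := hpre i x
        rw [hz] at hx
        have hagree : agreeOn (fun i => A.sampleSpace i)
            (B.map (Fin.castLEEmb i.2.le) : Set (Fin p)) x y ↔
            ∀ j ∈ B, x (Fin.castLE i.2.le j) = y (Fin.castLE i.2.le j) := by
          refine ⟨fun h j hj => h _ (mem_coe.2 (mem_map.2 ⟨j, hj, rfl⟩)), fun h j hj => ?_⟩
          obtain ⟨l, hl, rfl⟩ := mem_map.1 (mem_coe.1 hj)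
          exact h l hl
        rw [hagree, ← hsub, hx.2]
        constructor
        · intro h
          have hy : (fun l => run hA y (Fin.castLE i.2.le l)) ∈
            A.pathsTo i (A.src (run hA x i)) := (stateRel_iff hA).1 h ▸ hpre i y
          rw [hz] at hy
          exact hy.2.symm
        · intro h
          have hy : (fun l => run hA y (Fin.castLE i.2.le l)) ∈
            A.pathsTo i (A.src (run hA x i)) := by
            rw [hz]
            exact ⟨⟨_, hpre i y⟩, h.symm⟩
          exact (eq_of_isPath hy (hpre i y) fun _ => rfl).2
  · intro h i _ hip
    obtain ⟨B, hlt, hB⟩ := h ⟨i, hip⟩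
    refine ⟨univ.filter fun j => Fin.castLE hip.le j ∈ B, fun w ⟨f, hf⟩ => ?_⟩
    refine ⟨A.subvector _ f, ⟨f, ⟨w, hf⟩, rfl⟩, ?_⟩
    obtain ⟨x, hx, hxw⟩ := exists_run_extends hA hip.le hf
    obtain rfl : (fun l => run hA x (Fin.castLE hip.le l)) = f := funext hx
    have hagree : ∀ y, stateRel hA ⟨i, hip⟩ y x ↔
        ∀ j ∈ univ.filter fun j => Fin.castLE hip.le j ∈ B,
          y (Fin.castLE hip.le j) = x (Fin.castLE hip.le j) := by
      intro y
      rw [hB]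
      refine ⟨fun h j hj => h _ (mem_filter.1 hj).2, fun h j hj => ?_⟩
      exact h ⟨j, hlt j hj⟩ (by simpa using hj)
    ext e
    constructor
    · intro he
      refine ⟨⟨w, he⟩, ?_⟩
      obtain ⟨y, hy, hyw⟩ := exists_run_extends hA hip.le he
      obtain rfl : (fun l => run hA y (Fin.castLE hip.le l)) = e := funext hy
      exact (hsub ⟨i, hip⟩ _ y x).2 ((hagree y).1 ((hyw hip).trans (hxw hip).symm))
    · rintro ⟨⟨w', he⟩, hsv⟩
      obtain ⟨y, hy, hyw⟩ := exists_run_extends hA hip.le he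
      obtain rfl : (fun l => run hA y (Fin.castLE hip.le l)) = e := funext hy
      have := (hagree y).2 ((hsub ⟨i, hip⟩ _ y x).1 hsv)
      obtain rfl : w' = w := (hyw hip).symm.trans (Eq.trans this (hxw hip))
      exact he

end APFA

/-! ### The main theorem -/

theorem theorem1 {V E S : Type*} [Fintype E] {p : ℕ} (A : APFA V E S p)
    (hcomplete : A.IsComplete) (hvalues : ∀ i, 2 ≤ (A.sampleSpace i).card) :
    ((∃ G : Digraph (Fin p), (∀ i j, G.Adj i j → i < j) ∧
        A.model = directedModel (fun i => A.sampleSpace i) G) ↔ A.PropertyQ) ∧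
    ((∃ H : SimpleGraph (Fin p),
        A.model = undirectedModel (fun i => A.sampleSpace i) H) ↔ A.PropertyQ) := by
  classical
  have : ∀ i, Nontrivial (A.sampleSpace i) := fun i =>
    Fintype.one_lt_card_iff_nontrivial.1 (by rw [Fintype.card_coe]; exact hvalues i)
  have hcausal := APFA.causal_stateRel hcomplete
  rw [APFA.model_eq_kernelModel hcomplete, APFA.propertyQ_iff hcomplete]
  refine ⟨⟨?_, fun hQ => ?_⟩, ⟨?_, fun hQ => ?_⟩⟩
  · rintro ⟨G, hG, hmodel⟩ i
    refine ⟨univ.filter fun j => G.Adj j i, fun j hj => hG j i (mem_filter.1 hj).2,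
      fun x y => ?_⟩
    rw [rel_iff_sameConditional hcausal, hmodel, directedModel_eq_kernelModel,
      ← rel_iff_sameConditional (show Causal fun i => agreeOn _ {j | G.Adj j i} from
        fun i x y h j hj => h j (hG j i hj))]
    exact ⟨fun h j hj => h j (mem_filter.1 (mem_coe.1 hj)).2,
      fun h j hj => h j (mem_coe.2 (mem_filter.2 ⟨mem_univ _, hj⟩))⟩
  · choose B hlt hB using hQ
    refine ⟨⟨fun j i => j ∈ B i⟩, fun j i h => hlt i j h, ?_⟩
    rw [directedModel_eq_kernelModel]
    exact congrArg kernelModel (funext fun i => Setoid.ext fun x y => hB i x y)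
  · rintro ⟨H, hmodel⟩ i
    refine ⟨boundary H i, fun j hj => lt_of_mem_boundary hj, fun x y => ?_⟩
    rw [rel_iff_sameConditional hcausal, hmodel, agreeOn_boundary_iff]
  · choose B hlt hB using hQ
    refine ⟨skeleton B, ?_⟩
    -- Suppose `j ∈ B m` but `j ∉ B i`. Changing the value at `j` leaves the state at level `i` and
    -- the symbols from there on unchanged, hence also the state at level `m`, against `j ∈ B m`.
    have hmono : ∀ i m j, i ≤ m → j < i → j ∈ B m → j ∈ B i := by
      intro i m j him hji hj
      by_contra hjB
      obtain ⟨x⟩ : Nonempty ((i : Fin p) → A.sampleSpace i) := inferInstance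
      obtain ⟨a, ha⟩ := exists_ne (x j)
      have hi : APFA.stateRel hcomplete i (update x j a) x :=
        (hB i _ _).2 fun l hl => update_of_ne (ne_of_mem_of_not_mem hl hjB) _ _
      have hm := APFA.stateRel_of_le hcomplete him hi fun l hl _ =>
        update_of_ne (hji.trans_le hl).ne' _ _
      have hj' := (hB m _ _).1 hm j hj
      rw [update_self] at hj'
      exact ha hj'
    rw [← kernelModel_eq_undirectedModel hmono hlt]
    exact congrArg kernelModel (funext fun i => Setoid.ext fun x y => hB i x y)
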